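/- Let $d\ge 2$. For a unit vector $\psi\in\mathbb C^d\otimes\mathbb C^d$ let $s_1(\psi)\ge\dots\ge s_d(\psi)\ge 0$ be its Schmidt coefficients. For $\alpha\in[1,d]$ write $k=\lfloor\alpha\rfloor$, $\theta=\alpha-k$, $r=\lceil\alpha\rceil$, and let $\mathcal V_\alpha$ be the set of unit vectors $\psi$ such that $s_j(\psi)=0$ for all $j\ge r+1$ and, if $\theta>0$, $s_{k+1}(\psi)\le\frac{\theta}{k}\sum_{j=1}^k s_j(\psi)$. Let $\mathsf K_\alpha$ be the closed convex cone generated by $\{\psi\psi^*:\psi\in\mathcal V_\alpha\}$, and for a nonzero positive semidefinite $\rho$ on $\mathbb C^d\otimes\mathbb C^d$ define its fractional Schmidt index by $\mathrm{FSN}(\rho)=\inf\{\alpha\in[1,d]:\rho\in\mathsf K_\alpha\}$. Put $\omega=\frac1{\sqrt d}\sum_{i=1}^d e_i\otimes e_i$, $P_\omega=\omega\omega^*$, and $$\rho_F=\frac{1-F}{d^2-1}(I-P_\omega)+F\,P_\omega\qquad(0\le F\le 1).$$ Let $f_d(\alpha)=\max_{\psi\in\mathcal V_\alpha}\langle\psi,P_\omega\psi\rangle$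 for $\alpha\in[1,d]$. This maximum exists, and $$f_d(\alpha)=\frac{(k+\theta)^2}{d\,(k+\theta^2)},\qquad k=\lfloor\alpha\rfloor,\ \theta=\alpha-k.$$ Moreover: (i) If $0\le F\le\frac1d$, then $\mathrm{FSN}(\rho_F)=1$. (ii) If $\frac1d<F\le 1$, then there is a unique $\alpha\in(1,d]$ with $F=f_d(\alpha)$, and $\mathrm{FSN}(\rho_F)=\alpha$. More precisely, if $k\in\{1,\dots,d-1\}$ and $F\in[\frac kd,\frac{k+1}d]$, then the equation $$(Fd-1)\theta^2-2k\theta+k(Fd-k)=0$$ has a unique solution $\theta=\theta(F)\in[0,1]$, and $\mathrm{FSN}(\rho_F)=k+\theta(F)$. If $F>\frac kd$, then $Fd-1>0$, the radicand below is nonnegative, and $$\theta(F)=\frac{k-\sqrt{k^2-k(Fd-1)(Fd-k)}}{Fd-1}.$$ If $F=\frac kd$, then $\theta(F)=0$. -/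

import Mathlib

noncomputable section

/-- The matricization of a vector of `ℂⁿ ⊗ ℂᵐ`: the matrix `[a_{ij}]` of its coefficients in the
basis `e_i ⊗ f_j`. The tensor product `ℂⁿ ⊗ ℂᵐ` is realized as the Hilbert space of families
indexed by `Fin n × Fin m`, and `M_n ⊗ M_m` as the matrices indexed by `Fin n × Fin m`. -/
def matricization {n m : ℕ} (ψ : EuclideanSpace ℂ (Fin n × Fin m)) :
    Matrix (Fin n) (Fin m) ℂ :=
  Matrix.of fun i j => ψ (i, j)

/-- The Schmidt coefficients of `ψ` in decreasing order, extended by zeros: the singular values of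
its matricization. The numbering starts at `0`, so `schmidtCoeff ψ j` is `s_{j+1}(ψ)`. -/
def schmidtCoeff {n m : ℕ} (ψ : EuclideanSpace ℂ (Fin n × Fin m)) (j : ℕ) : ℝ :=
  (Matrix.toEuclideanLin (matricization ψ)).singularValues j

/-- The set `V_α` of `α`-admissible unit vectors: with `k = ⌊α⌋`, `θ = α - k`, `r = ⌈α⌉`, one
requires `s_j(ψ) = 0` for `j ≥ r + 1` and, if `θ > 0`, `s_{k+1}(ψ) ≤ (θ / k) ∑_{j ≤ k} s_j(ψ)`. -/
def admissible (n m : ℕ) (α : ℝ) : Set (EuclideanSpace ℂ (Fin n × Fin m)) :=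
  {ψ | ‖ψ‖ = 1 ∧
    (∀ j : ℕ, ⌈α⌉₊ ≤ j → schmidtCoeff ψ j = 0) ∧
    (0 < α - ⌊α⌋₊ →
      schmidtCoeff ψ ⌊α⌋₊ ≤
        (α - ⌊α⌋₊) / ⌊α⌋₊ * ∑ j ∈ Finset.range ⌊α⌋₊, schmidtCoeff ψ j)}

/-- The rank-one matrix `ψψ*`. -/
def rankOne {ι : Type*} (ψ : EuclideanSpace ℂ ι) : Matrix ι ι ℂ :=
  Matrix.vecMulVec (fun i => ψ i) (fun j => star (ψ j))

/-- The fractional `α`-superpositive cone `K_α`: the closed convex cone generated by the `ψψ*` with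
`ψ` an `α`-admissible unit vector. -/
def fracCone (n m : ℕ) (α : ℝ) : Set (Matrix (Fin n × Fin m) (Fin n × Fin m) ℂ) :=
  closure (PointedCone.hull ℝ (rankOne '' admissible n m α) :
    Set (Matrix (Fin n × Fin m) (Fin n × Fin m) ℂ))

/-- The fractional Schmidt index: the infimum of all `α ∈ [1, d]` with `ρ ∈ K_α`, where
`d = min {n, m}`. -/
def fracSchmidtIndex {n m : ℕ} (ρ : Matrix (Fin n × Fin m) (Fin n × Fin m) ℂ) : ℝ :=
  sInf {α : ℝ | α ∈ Set.Icc (1 : ℝ) ((min n m : ℕ) : ℝ) ∧ ρ ∈ fracCone n m α}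

/-- The quadratic form `⟨ψ, Wψ⟩`, which is real for the Hermitian `W` it is used for. -/
def quadForm {ι : Type*} [Fintype ι] (W : Matrix ι ι ℂ) (ψ : EuclideanSpace ℂ ι) : ℝ :=
  (∑ i, star (ψ i) * ∑ j, W i j * ψ j).re

/-- The maximum `μ_α(W)` of `⟨ψ, Wψ⟩` over the `α`-admissible unit vectors. -/
def muAlpha {n m : ℕ} (α : ℝ) (W : Matrix (Fin n × Fin m) (Fin n × Fin m) ℂ) : ℝ :=
  sSup (quadForm W '' admissible n m α)

/-- The maximally entangled unit vector `ω = d^{-1/2} ∑ e_i ⊗ e_i`. -/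
def maxEntangled (d : ℕ) : EuclideanSpace ℂ (Fin d × Fin d) :=
  ((1 / Real.sqrt d : ℝ) : ℂ) • ∑ i : Fin d, EuclideanSpace.single (i, i) (1 : ℂ)

/-- The projection `P_ω = ωω*`. -/
def projMaxEntangled (d : ℕ) : Matrix (Fin d × Fin d) (Fin d × Fin d) ℂ :=
  rankOne (maxEntangled d)

/-- The isotropic state `ρ_F = (1 - F) / (d² - 1) (I - P_ω) + F P_ω`. -/
def isotropicState (d : ℕ) (F : ℝ) : Matrix (Fin d × Fin d) (Fin d × Fin d) ℂ :=
  ((1 - F) / ((d : ℝ) ^ 2 - 1)) • (1 - projMaxEntangled d) + F • projMaxEntangled d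

/-- The profile function `f_d(α) = μ_α(P_ω)`. -/
def isotropicProfile (d : ℕ) (α : ℝ) : ℝ :=
  muAlpha α (projMaxEntangled d)

end

/-!
Let `A` be the matricization of a vector `ψ`, so that `⟨ψ, P_ω ψ⟩ = |tr A|² / d`.

*The profile.* Expanding the trace in an orthonormal eigenbasis of `Aᴴ * A` gives
`|tr A| ≤ ∑ s_j(ψ)`, while `∑ s_j(ψ)² = ‖ψ‖²`. The maximal overlap is thus at most the solution of
an extremal problem for the Schmidt coefficients, which Cauchy-Schwarz reduces to a quadratic
inequality in two variables (`sq_sum_mul_le_of_le_mul_sum`). Equality holds for a diagonal `A` with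
entries proportional to `1, …, 1, θ` (`exists_mem_admissible_quadForm_eq`).

*Membership.* The isotropic state `ρ_F` lies in `K_α` if and only if `F ≤ f_d(α)`
(`isotropicState_mem_fracCone_iff`). Necessity holds because `tr (P_ω ρ) ≤ f_d(α) * tr ρ` on the
generators of `K_α`, hence on `K_α`. For sufficiency, mixing an optimal `ψψ*` with the product state
of `e_1 ⊗ e_2`, whose overlap is zero, gives an element of `K_α` of trace one and overlap `F`.
Instead of averaging it over the unitary group, consider all elements of `K_α` with this trace and
overlap: they form a closed convex set invariant under conjugation by the matrices `U ⊗ Ū`, since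
these preserve Schmidt coefficients and fix `ω`. Its element of least Frobenius norm is unique,
hence commutes with every `U ⊗ Ū`, hence is a combination of `1` and `P_ω`
(`exists_eq_smul_one_add_smul_projMaxEntangled`); its trace and overlap identify it as `ρ_F`.

*Inversion.* Therefore the index of `ρ_F` is the infimum of the `α` with `F ≤ f_d(α)`. The profile
is strictly increasing on `[1, d]` (`strictMonoOn_isotropicProfile`), with `f_d(1) = 1 / d`, and on
`[k, k + 1]` the equation `F = f_d(k + θ)` is the quadratic equation for `θ`, whose smaller root
lies in `[0, 1]`.
-/

section

open Matrix
open scoped Kronecker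

/-! ### Schmidt coefficients -/

theorem charpoly_toEuclideanLin {n : Type*} [Fintype n] [DecidableEq n] (M : Matrix n n ℂ) :
    (toEuclideanLin M).charpoly = M.charpoly := by
  rw [toEuclideanLin_eq_toLin_orthonormal, Matrix.charpoly_toLin]

theorem adjoint_comp_self_toEuclideanLin {m n : Type*} [Fintype m] [Fintype n] [DecidableEq m]
    [DecidableEq n] (A : Matrix m n ℂ) :
    LinearMap.adjoint (toEuclideanLin A) ∘ₗ toEuclideanLin A = toEuclideanLin (Aᴴ * A) := by
  rw [← Matrix.toEuclideanLin_conjTranspose_eq_adjoint]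
  ext v i
  simp [Matrix.toLpLin_apply, Matrix.mulVec_mulVec]

/-- The Schmidt coefficients of a vector with matricization `A` depend only on the characteristic
polynomial of `Aᴴ * A`. -/
theorem schmidtCoeff_eq_of_charpoly_eq {d : ℕ} {ψ φ : EuclideanSpace ℂ (Fin d × Fin d)}
    (h : ((matricization ψ)ᴴ * matricization ψ).charpoly =
      ((matricization φ)ᴴ * matricization φ).charpoly) (j : ℕ) :
    schmidtCoeff ψ j = schmidtCoeff φ j := by
  unfold schmidtCoeff
  have hn : Module.finrank ℂ (EuclideanSpace ℂ (Fin d)) = d := finrank_euclideanSpace_fin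
  by_cases hj : j < d
  · rw [LinearMap.singularValues_of_lt _ hn hj, LinearMap.singularValues_of_lt _ hn hj]
    congr 1
    refine congrFun ((LinearMap.IsSymmetric.eigenvalues_eq_eigenvalues_iff _ hn _ hn).2 ?_) _
    rw [adjoint_comp_self_toEuclideanLin,
      adjoint_comp_self_toEuclideanLin, charpoly_toEuclideanLin, charpoly_toEuclideanLin, h]
  · rw [LinearMap.singularValues_of_finrank_le, LinearMap.singularValues_of_finrank_le] <;>
      simpa using hj

/-- The Schmidt coefficients of `∑ i, σ i • e_i ⊗ e_i` with `σ` decreasing and nonnegative. -/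
theorem schmidtCoeff_of_diagonal {d : ℕ} {ψ : EuclideanSpace ℂ (Fin d × Fin d)} {σ : Fin d → ℝ}
    (hσ : Antitone σ) (h0 : ∀ i, 0 ≤ σ i)
    (hψ : matricization ψ = Matrix.diagonal fun i => (σ i : ℂ)) (j : Fin d) :
    schmidtCoeff ψ j = σ j := by
  unfold schmidtCoeff
  have hn : Module.finrank ℂ (EuclideanSpace ℂ (Fin d)) = d := finrank_euclideanSpace_fin
  set T := toEuclideanLin (matricization ψ) with hT
  have key := T.isSymmetric_adjoint_comp_self.sort_roots_charpoly_eq_eigenvalues hn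
  have h1 : (LinearMap.adjoint T ∘ₗ T).charpoly.roots.map RCLike.re =
      Multiset.map (fun i => σ i ^ 2) (Finset.univ : Finset (Fin d)).val := by
    have hdiag : (diagonal fun i => (σ i : ℂ))ᴴ * (diagonal fun i => (σ i : ℂ)) =
        diagonal fun i => ((σ i ^ 2 : ℝ) : ℂ) := by
      simp [Matrix.diagonal_conjTranspose, sq]
    rw [hT, adjoint_comp_self_toEuclideanLin, charpoly_toEuclideanLin, hψ, hdiag,
      Matrix.charpoly_diagonal, Polynomial.roots_prod _ _
        (Finset.prod_ne_zero_iff.2 fun i _ => Polynomial.X_sub_C_ne_zero _)]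
    simp only [Polynomial.roots_X_sub_C, Multiset.bind_singleton, Multiset.map_map,
      Function.comp_def, RCLike.re_eq_complex_re, Complex.ofReal_re]
  have h2 : (Multiset.map (fun i => σ i ^ 2) (Finset.univ : Finset (Fin d)).val).sort (· ≥ ·) =
      List.ofFn (fun i => σ i ^ 2) := by
    simp_rw [Fin.univ_val_map, Multiset.coe_sort]
    convert! List.mergeSort_of_pairwise ?_
    simp_rw [decide_eq_true_eq, ← List.sortedGE_iff_pairwise]
    have : Antitone (fun i => σ i ^ 2) := fun i j hij => pow_le_pow_left₀ (h0 _) (hσ hij) 2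
    exact this.sortedGE_ofFn
  rw [h1, h2, List.ofFn_inj] at key
  rw [T.singularValues_fin hn, ← key]
  exact Real.sqrt_sq (h0 j)

theorem norm_sq_eq_trace {d : ℕ} (ψ : EuclideanSpace ℂ (Fin d × Fin d)) :
    ((‖ψ‖ ^ 2 : ℝ) : ℂ) = ((matricization ψ)ᴴ * matricization ψ).trace := by
  rw [EuclideanSpace.norm_sq_eq, Fintype.sum_prod_type, Finset.sum_comm]
  simp [Matrix.trace, Matrix.mul_apply, matricization, ← Complex.normSq_eq_conj_mul_self,
    Complex.normSq_eq_norm_sq]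

theorem sum_sq_schmidtCoeff {d : ℕ} (ψ : EuclideanSpace ℂ (Fin d × Fin d)) :
    ∑ j ∈ Finset.range d, schmidtCoeff ψ j ^ 2 = ‖ψ‖ ^ 2 := by
  have hn : Module.finrank ℂ (EuclideanSpace ℂ (Fin d)) = d := finrank_euclideanSpace_fin
  rw [← Fin.sum_univ_eq_sum_range (fun j => schmidtCoeff ψ j ^ 2)]
  unfold schmidtCoeff
  simp_rw [LinearMap.sq_singularValues_fin _ hn]
  have h := LinearMap.IsSymmetric.trace_eq_sum_eigenvalues hn
    (toEuclideanLin (matricization ψ)).isSymmetric_adjoint_comp_self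
  have htr : LinearMap.trace ℂ _ (LinearMap.adjoint (toEuclideanLin (matricization ψ)) ∘ₗ
      toEuclideanLin (matricization ψ)) = ((‖ψ‖ ^ 2 : ℝ) : ℂ) := by
    rw [adjoint_comp_self_toEuclideanLin, toEuclideanLin_eq_toLin_orthonormal,
      Matrix.trace_toLin_eq, ← norm_sq_eq_trace]
  exact Complex.ofReal_injective (h.symm.trans htr)

/-- `|tr A| ≤ ‖A‖₁`: expand the trace in an orthonormal eigenbasis of `Aᴴ * A`. -/
theorem norm_trace_le_sum_schmidtCoeff {d : ℕ} (ψ : EuclideanSpace ℂ (Fin d × Fin d)) :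
    ‖(matricization ψ).trace‖ ≤ ∑ j ∈ Finset.range d, schmidtCoeff ψ j := by
  have hn : Module.finrank ℂ (EuclideanSpace ℂ (Fin d)) = d := finrank_euclideanSpace_fin
  rw [← Fin.sum_univ_eq_sum_range (fun j => schmidtCoeff ψ j)]
  unfold schmidtCoeff
  set T := toEuclideanLin (matricization ψ) with hT
  set b := T.isSymmetric_adjoint_comp_self.eigenvectorBasis hn with hb
  have htr : (matricization ψ).trace = ∑ j, inner ℂ (b j) (T (b j)) := by
    rw [← LinearMap.trace_eq_sum_inner, hT, toEuclideanLin_eq_toLin_orthonormal,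
      Matrix.trace_toLin_eq]
  have hnorm (j : Fin d) : ‖T (b j)‖ = T.singularValues j := by
    rw [← sq_eq_sq₀ (norm_nonneg _) (T.singularValues_nonneg _), T.sq_singularValues_fin hn]
    have h1 : inner ℂ (b j) ((LinearMap.adjoint T ∘ₗ T) (b j)) = ((‖T (b j)‖ ^ 2 : ℝ) : ℂ) := by
      rw [LinearMap.comp_apply, LinearMap.adjoint_inner_right, inner_self_eq_norm_sq_to_K]
      norm_cast
    rw [hb, LinearMap.IsSymmetric.apply_eigenvectorBasis, ← hb, inner_smul_right,
      inner_self_eq_norm_sq_to_K, b.orthonormal.1 j] at h1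
    have h2 : ((T.isSymmetric_adjoint_comp_self.eigenvalues hn j : ℝ) : ℂ) =
      ((‖T (b j)‖ ^ 2 : ℝ) : ℂ) := by simpa using h1
    exact_mod_cast h2.symm
  rw [htr]
  refine (norm_sum_le _ _).trans (Finset.sum_le_sum fun j _ => ?_)
  refine (norm_inner_le_norm _ _).trans ?_
  rw [b.orthonormal.1 j, one_mul, hnorm]

theorem schmidtCoeff_nonneg {d : ℕ} (ψ : EuclideanSpace ℂ (Fin d × Fin d)) (j : ℕ) :
    0 ≤ schmidtCoeff ψ j :=
  LinearMap.singularValues_nonneg _ j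

/-- A vector with matricization of rank at most one is a product vector: only its first Schmidt
coefficient can be nonzero. -/
theorem schmidtCoeff_eq_zero_of_rank_le_one {d : ℕ} {ψ : EuclideanSpace ℂ (Fin d × Fin d)}
    (h : (matricization ψ).rank ≤ 1) {j : ℕ} (hj : 1 ≤ j) : schmidtCoeff ψ j = 0 := by
  unfold schmidtCoeff
  rw [LinearMap.singularValues_eq_zero_iff_le_finrank_range]
  rw [Matrix.rank_eq_finrank_range_toLin _ (EuclideanSpace.basisFun (Fin d) ℂ).toBasis
    (EuclideanSpace.basisFun (Fin d) ℂ).toBasis, ← toEuclideanLin_eq_toLin_orthonormal] at h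
  exact h.trans hj

/-! ### The overlap with the maximally entangled vector -/

theorem projMaxEntangled_apply {d : ℕ} (p q : Fin d × Fin d) :
    projMaxEntangled d p q = if p.1 = p.2 ∧ q.1 = q.2 then (1 / d : ℂ) else 0 := by
  have h (p : Fin d × Fin d) : maxEntangled d p =
      if p.1 = p.2 then ((1 / Real.sqrt d : ℝ) : ℂ) else 0 := by
    obtain ⟨i, j⟩ := p
    simp only [maxEntangled, PiLp.smul_apply, WithLp.ofLp_sum, Finset.sum_apply,
      PiLp.single_apply, smul_eq_mul, Prod.mk.injEq]
    by_cases hij : i = j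
    · subst hij; simp
    · rw [Finset.sum_eq_zero]
      · simp [hij]
      · intro x _
        rw [if_neg]
        rintro ⟨rfl, rfl⟩
        exact hij rfl
  rw [projMaxEntangled, rankOne, Matrix.vecMulVec_apply, h, h]
  by_cases h1 : p.1 = p.2 <;> by_cases h2 : q.1 = q.2 <;> simp [h1, h2]
  rw [← mul_inv, ← Complex.ofReal_mul, Real.mul_self_sqrt (Nat.cast_nonneg d)]
  simp

theorem trace_mul_rankOne {ι : Type*} [Fintype ι] (W : Matrix ι ι ℂ) (ψ : EuclideanSpace ℂ ι) :
    (W * rankOne ψ).trace = ∑ i, star (ψ i) * ∑ j, W i j * ψ j := by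
  simp only [Matrix.trace, Matrix.diag_apply, Matrix.mul_apply, rankOne, Matrix.vecMulVec_apply,
    Finset.mul_sum]
  refine Finset.sum_congr rfl fun i _ => Finset.sum_congr rfl fun j _ => ?_
  ring

theorem quadForm_eq_re_trace {ι : Type*} [Fintype ι] (W : Matrix ι ι ℂ)
    (ψ : EuclideanSpace ℂ ι) : quadForm W ψ = (W * rankOne ψ).trace.re := by
  rw [quadForm, trace_mul_rankOne]

theorem trace_projMaxEntangled_mul_rankOne {d : ℕ} (ψ : EuclideanSpace ℂ (Fin d × Fin d)) :
    (projMaxEntangled d * rankOne ψ).trace = ((‖(matricization ψ).trace‖ ^ 2 / d : ℝ) : ℂ) := by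
  have h (p : Fin d × Fin d) : ∑ q, projMaxEntangled d p q * ψ q =
      if p.1 = p.2 then (1 / d : ℂ) * (matricization ψ).trace else 0 := by
    by_cases hp : p.1 = p.2
    · simp [projMaxEntangled_apply, hp, Fintype.sum_prod_type, Matrix.trace, matricization,
        Finset.mul_sum]
    · simp [projMaxEntangled_apply, hp]
  simp_rw [trace_mul_rankOne, h, Fintype.sum_prod_type]
  simp only [mul_ite, mul_zero, Finset.sum_ite_eq, Finset.mem_univ, if_true]
  rw [← Finset.sum_mul]
  have : ∑ i, star (ψ (i, i)) = star (matricization ψ).trace := by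
    simp [Matrix.trace, matricization]
  rw [this, Complex.ofReal_div, ← Complex.normSq_eq_norm_sq, Complex.normSq_eq_conj_mul_self]
  simp
  ring

theorem quadForm_projMaxEntangled {d : ℕ} (ψ : EuclideanSpace ℂ (Fin d × Fin d)) :
    quadForm (projMaxEntangled d) ψ = ‖(matricization ψ).trace‖ ^ 2 / d := by
  rw [quadForm_eq_re_trace, trace_projMaxEntangled_mul_rankOne, Complex.ofReal_re]

/-! ### The maximum of the overlap over admissible vectors -/

theorem sum_range_eq_sum_range_succ_of_eq_zero {s : ℕ → ℝ} {k d : ℕ} (hkd : k ≤ d)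
    (hs : ∀ j, k + 1 ≤ j → s j = 0) (hd : s d = 0) :
    ∑ j ∈ Finset.range d, s j = ∑ j ∈ Finset.range (k + 1), s j := by
  rcases hkd.lt_or_eq with h | rfl
  · refine (Finset.sum_subset (Finset.range_mono h) fun j _ hj => hs j ?_).symm
    simpa using hj
  · rw [Finset.sum_range_succ, hd, add_zero]

/-- The extremal problem behind the profile: the ratio of the square of the `ℓ¹` norm to the square
of the `ℓ²` norm, for a vector with `k` entries of sum `S` and one further entry
`s k ≤ (θ / k) * S`. By Cauchy-Schwarz the `k` entries may be taken equal, and what remains is a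
quadratic inequality in `S` and `s k` that factors. -/
theorem sq_sum_mul_le_of_le_mul_sum {s : ℕ → ℝ} {k : ℕ} {θ : ℝ} (hk : 1 ≤ k) (h0 : ∀ j, 0 ≤ s j)
    (hθ0 : 0 ≤ θ) (hθ1 : θ ≤ 1) (hsk : s k ≤ θ / k * ∑ j ∈ Finset.range k, s j) :
    (∑ j ∈ Finset.range (k + 1), s j) ^ 2 * (k + θ ^ 2) ≤
      (k + θ) ^ 2 * ∑ j ∈ Finset.range (k + 1), s j ^ 2 := by
  rw [Finset.sum_range_succ, Finset.sum_range_succ]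
  have hcs : (∑ j ∈ Finset.range k, s j) ^ 2 ≤ k * ∑ j ∈ Finset.range k, s j ^ 2 := by
    simpa using sq_sum_le_card_mul_sum_sq (s := Finset.range k) (f := s)
  have hS : 0 ≤ ∑ j ∈ Finset.range k, s j := Finset.sum_nonneg fun j _ => h0 j
  generalize ∑ j ∈ Finset.range k, s j = S at *
  generalize ∑ j ∈ Finset.range k, s j ^ 2 = Q at *
  have ht := h0 k
  generalize s k = t at *
  have hk1 : (1 : ℝ) ≤ k := by exact_mod_cast hk
  generalize (k : ℝ) = x at *
  have hx : 0 < x := by linarith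
  have h1 : x * t ≤ θ * S := by
    have := mul_le_mul_of_nonneg_left hsk hx.le
    calc x * t ≤ x * (θ / x * S) := this
      _ = θ * S := by field_simp
  have h2 : 0 ≤ (2 * x + θ - x * θ) * S - (x + 2 * θ - 1) * (x * t) := by
    have h3 : (x + 2 * θ - 1) * (x * t) ≤ (x + 2 * θ - 1) * (θ * S) :=
      mul_le_mul_of_nonneg_left h1 (by linarith)
    have h4 : 0 ≤ 2 * S * (x + θ) * (1 - θ) := by
      have : 0 ≤ 1 - θ := by linarith
      positivity
    linarith
  have h5 := mul_nonneg (sub_nonneg.2 h1) h2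
  have h6 := mul_le_mul_of_nonneg_left hcs (sq_nonneg (x + θ))
  refine le_of_mul_le_mul_left ?_ hx
  linarith

/-- The data `k = ⌊α⌋`, `θ = α - k` of a parameter `α ∈ [1, d]`. -/
theorem floor_bounds {d : ℕ} {α : ℝ} (hα : α ∈ Set.Icc (1 : ℝ) d) :
    1 ≤ ⌊α⌋₊ ∧ ⌊α⌋₊ ≤ d ∧ 0 ≤ α - ⌊α⌋₊ ∧ α - ⌊α⌋₊ < 1 ∧ (⌊α⌋₊ = d → α - ⌊α⌋₊ = 0) := by
  have h0 : 0 ≤ α := zero_le_one.trans hα.1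
  refine ⟨Nat.le_floor (by simpa using hα.1), Nat.floor_le_of_le hα.2,
    sub_nonneg.2 (Nat.floor_le h0), by linarith [Nat.lt_floor_add_one α], fun h => ?_⟩
  have := Nat.floor_le h0
  rw [h] at this ⊢
  linarith [hα.2]

theorem quadForm_le_of_mem_admissible {d : ℕ} {α : ℝ} (hα : α ∈ Set.Icc (1 : ℝ) d)
    {ψ : EuclideanSpace ℂ (Fin d × Fin d)} (hψ : ψ ∈ admissible d d α) :
    quadForm (projMaxEntangled d) ψ ≤
      ((⌊α⌋₊ : ℝ) + (α - ⌊α⌋₊)) ^ 2 / (d * ((⌊α⌋₊ : ℝ) + (α - ⌊α⌋₊) ^ 2)) := by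
  obtain ⟨hk1, hkd, hθ0, hθ1, -⟩ := floor_bounds hα
  obtain ⟨hnorm, hzero, hle⟩ := hψ
  have hsk : schmidtCoeff ψ ⌊α⌋₊ ≤
      (α - ⌊α⌋₊) / ⌊α⌋₊ * ∑ j ∈ Finset.range ⌊α⌋₊, schmidtCoeff ψ j := by
    rcases hθ0.eq_or_lt with h | h
    · rw [hzero _ (Nat.ceil_le.2 (by linarith)), ← h]
      simp
    · exact hle h
  have hs : ∀ j, ⌊α⌋₊ + 1 ≤ j → schmidtCoeff ψ j = 0 := fun j hj =>
    hzero j ((Nat.ceil_le_floor_add_one α).trans hj)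
  have hd : schmidtCoeff ψ d = 0 := hzero d (Nat.ceil_le.2 hα.2)
  have key := sq_sum_mul_le_of_le_mul_sum hk1 (schmidtCoeff_nonneg ψ) hθ0 hθ1.le hsk
  have hsq := sum_sq_schmidtCoeff ψ
  rw [sum_range_eq_sum_range_succ_of_eq_zero hkd (fun j hj => by rw [hs j hj]; simp)
    (by rw [hd]; simp), hnorm, one_pow] at hsq
  have htr := norm_trace_le_sum_schmidtCoeff ψ
  rw [sum_range_eq_sum_range_succ_of_eq_zero hkd hs hd] at htr
  have hsq2 := pow_le_pow_left₀ (norm_nonneg _) htr 2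
  have hkpos : (0 : ℝ) < ⌊α⌋₊ := by exact_mod_cast hk1
  have hdpos : (0 : ℝ) < d := by exact_mod_cast hk1.trans hkd
  have hpos : 0 < (⌊α⌋₊ : ℝ) + (α - ⌊α⌋₊) ^ 2 := by positivity
  rw [hsq, mul_one] at key
  rw [quadForm_projMaxEntangled, mul_comm (d : ℝ), ← div_div]
  refine div_le_div_of_nonneg_right ?_ hdpos.le
  rw [le_div_iff₀ hpos]
  exact (mul_le_mul_of_nonneg_right hsq2 hpos.le).trans key

theorem sum_range_ite_lt_ite_eq {d k : ℕ} (hkd : k ≤ d) {x y : ℝ} (hy : k = d → y = 0) :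
    ∑ j ∈ Finset.range d, (if j < k then x else if j = k then y else 0) = k * x + y := by
  rw [sum_range_eq_sum_range_succ_of_eq_zero hkd, Finset.sum_range_succ,
    Finset.sum_congr rfl fun j hj => if_pos (Finset.mem_range.1 hj)]
  · simp
  · intro j hj
    rw [if_neg (by omega), if_neg (by omega)]
  · rw [if_neg (by omega)]
    split_ifs with h
    · exact hy h.symm
    · rfl

/-- The bound on the overlap with `ω` is attained by the Schmidt coefficients `a, …, a, θ * a`, with
`k` entries equal to `a = (k + θ²)^(-1/2)`. -/
theorem exists_mem_admissible_quadForm_eq {d : ℕ} {α : ℝ} (hα : α ∈ Set.Icc (1 : ℝ) d) :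
    ∃ ψ ∈ admissible d d α, quadForm (projMaxEntangled d) ψ =
      ((⌊α⌋₊ : ℝ) + (α - ⌊α⌋₊)) ^ 2 / (d * ((⌊α⌋₊ : ℝ) + (α - ⌊α⌋₊) ^ 2)) := by
  obtain ⟨hk1, hkd, hθ0, hθ1, hθd⟩ := floor_bounds hα
  have hkc : ⌈α⌉₊ ≤ ⌊α⌋₊ → α - ⌊α⌋₊ = 0 := fun h => by
    have h1 := Nat.le_ceil α
    have h2 : (⌈α⌉₊ : ℝ) ≤ ⌊α⌋₊ := by exact_mod_cast h
    linarith
  have hfc := Nat.floor_le_ceil α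
  have hk1' : (1 : ℝ) ≤ ⌊α⌋₊ := by exact_mod_cast hk1
  simp only [admissible, Set.mem_ofPred_eq]
  generalize α - ⌊α⌋₊ = θ at *
  generalize ⌊α⌋₊ = k at *
  have hpos : (0 : ℝ) < k + θ ^ 2 := by positivity
  set a : ℝ := (Real.sqrt (k + θ ^ 2))⁻¹ with ha
  have ha0 : 0 ≤ a := by positivity
  have ha2 : a ^ 2 = (k + θ ^ 2)⁻¹ := by
    rw [ha, inv_pow, Real.sq_sqrt hpos.le]
  set σ : ℕ → ℝ := fun j => if j < k then a else if j = k then θ * a else 0 with hσ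
  have hθa : θ * a ≤ a := mul_le_of_le_one_left ha0 hθ1.le
  have hσ0 : ∀ j, 0 ≤ σ j := fun j => by
    simp only [hσ]
    split_ifs <;> positivity
  have hσanti : Antitone σ := fun i j hij => by
    have : 0 ≤ θ * a := by positivity
    simp only [hσ]
    split_ifs <;> first | omega | linarith
  let ψ : EuclideanSpace ℂ (Fin d × Fin d) :=
    WithLp.toLp 2 fun p => if p.1 = p.2 then (σ p.1 : ℂ) else 0
  have hmat : matricization ψ = Matrix.diagonal fun i : Fin d => (σ i : ℂ) := by
    ext i j
    simp [ψ, matricization, Matrix.diagonal_apply]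
  have hs (j : ℕ) : schmidtCoeff ψ j = σ j := by
    by_cases hj : j < d
    · exact schmidtCoeff_of_diagonal (σ := fun i : Fin d => σ i) (fun i j hij => hσanti hij)
        (fun i => hσ0 i) hmat ⟨j, hj⟩
    · have h1 : schmidtCoeff ψ j = 0 :=
        LinearMap.singularValues_of_finrank_le _ (by simpa using hj)
      rw [h1]
      simp only [hσ]
      rw [if_neg (by omega)]
      split_ifs with h
      · rw [hθd (by omega), zero_mul]
      · rfl
  have hσsum : ∑ j ∈ Finset.range d, σ j = (k + θ) * a := by
    rw [hσ, sum_range_ite_lt_ite_eq hkd fun h => by rw [hθd h, zero_mul]]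
    ring
  refine ⟨ψ, ⟨?_, fun j hj => ?_, fun _ => ?_⟩, ?_⟩
  · have h1 := sum_sq_schmidtCoeff ψ
    have h2 (j : ℕ) : σ j ^ 2 = if j < k then a ^ 2 else if j = k then (θ * a) ^ 2 else 0 := by
      simp only [hσ]
      split_ifs <;> simp
    simp_rw [hs, h2] at h1
    rw [sum_range_ite_lt_ite_eq hkd fun h => by rw [hθd h]; simp, mul_pow, ← add_mul, ha2,
      mul_inv_cancel₀ hpos.ne'] at h1
    exact (pow_eq_one_iff_of_nonneg (norm_nonneg ψ) two_ne_zero).1 h1.symm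
  · rw [hs]
    simp only [hσ]
    rw [if_neg (by omega)]
    split_ifs with h
    · rw [hkc (by omega), zero_mul]
    · rfl
  · have h1 : ∑ j ∈ Finset.range k, schmidtCoeff ψ j = k * a := by
      rw [Finset.sum_congr rfl fun j hj => (hs j).trans (if_pos (Finset.mem_range.1 hj))]
      simp
    rw [h1, hs]
    simp only [hσ]
    rw [if_neg (lt_irrefl k), if_pos trivial]
    apply le_of_eq
    field_simp
  · have h1 : (matricization ψ).trace = (((k + θ) * a : ℝ) : ℂ) := by
      rw [hmat, Matrix.trace_diagonal, ← hσsum, ← Fin.sum_univ_eq_sum_range]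
      push_cast
      rfl
    rw [quadForm_projMaxEntangled, h1, Complex.norm_real, Real.norm_eq_abs, sq_abs, mul_pow, ha2,
      mul_comm (d : ℝ), ← div_div, div_eq_mul_inv (_ ^ 2)]

/-- The profile is a maximum, with the explicit value. -/
theorem isGreatest_quadForm_admissible {d : ℕ} {α : ℝ} (hα : α ∈ Set.Icc (1 : ℝ) d) :
    IsGreatest (quadForm (projMaxEntangled d) '' admissible d d α)
      (((⌊α⌋₊ : ℝ) + (α - ⌊α⌋₊)) ^ 2 / (d * ((⌊α⌋₊ : ℝ) + (α - ⌊α⌋₊) ^ 2))) := by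
  refine ⟨exists_mem_admissible_quadForm_eq hα, ?_⟩
  rintro _ ⟨ψ, hψ, rfl⟩
  exact quadForm_le_of_mem_admissible hα hψ

theorem isotropicProfile_eq {d : ℕ} {α : ℝ} (hα : α ∈ Set.Icc (1 : ℝ) d) :
    isotropicProfile d α =
      ((⌊α⌋₊ : ℝ) + (α - ⌊α⌋₊)) ^ 2 / (d * ((⌊α⌋₊ : ℝ) + (α - ⌊α⌋₊) ^ 2)) :=
  (isGreatest_quadForm_admissible hα).csSup_eq

/-! ### Conjugation by `U ⊗ Ū` -/

/-- The matrix `U ⊗ Ū`, which acts on matricizations as `A ↦ U * A * Uᴴ`. -/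
def kroneckerConj {d : ℕ} (U : Matrix (Fin d) (Fin d) ℂ) :
    Matrix (Fin d × Fin d) (Fin d × Fin d) ℂ :=
  U ⊗ₖ U.map star

theorem kroneckerConj_apply {d : ℕ} (U : Matrix (Fin d) (Fin d) ℂ) (p q : Fin d × Fin d) :
    kroneckerConj U p q = U p.1 q.1 * star (U p.2 q.2) := rfl

theorem conjTranspose_kroneckerConj_mul_self {d : ℕ} {U : Matrix (Fin d) (Fin d) ℂ}
    (hU : Uᴴ * U = 1) : (kroneckerConj U)ᴴ * kroneckerConj U = 1 := by
  have h : (U.map star)ᴴ * U.map star = 1 := by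
    have := congrArg Matrix.transpose hU
    rw [Matrix.transpose_mul, Matrix.transpose_one] at this
    rw [← this]
    congr 1
    ext i j
    simp
  rw [kroneckerConj, Matrix.conjTranspose_kronecker, ← Matrix.mul_kronecker_mul, hU, h,
    Matrix.one_kronecker_one]

theorem matricization_kroneckerConj_mulVec {d : ℕ} (U : Matrix (Fin d) (Fin d) ℂ)
    (ψ : EuclideanSpace ℂ (Fin d × Fin d)) :
    matricization (WithLp.toLp 2 (kroneckerConj U *ᵥ ψ.ofLp)) = U * matricization ψ * Uᴴ := by
  ext i j
  simp only [matricization, Matrix.of_apply, Matrix.mulVec, dotProduct, kroneckerConj_apply,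
    Fintype.sum_prod_type, Matrix.mul_apply, Matrix.conjTranspose_apply, Finset.sum_mul]
  rw [Finset.sum_comm]
  refine Finset.sum_congr rfl fun l _ => Finset.sum_congr rfl fun k _ => ?_
  ring

theorem schmidtCoeff_kroneckerConj_mulVec {d : ℕ} {U : Matrix (Fin d) (Fin d) ℂ}
    (hU : Uᴴ * U = 1) (ψ : EuclideanSpace ℂ (Fin d × Fin d)) (j : ℕ) :
    schmidtCoeff (WithLp.toLp 2 (kroneckerConj U *ᵥ ψ.ofLp)) j = schmidtCoeff ψ j := by
  apply schmidtCoeff_eq_of_charpoly_eq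
  rw [matricization_kroneckerConj_mulVec]
  set A := matricization ψ
  have h : (U * A * Uᴴ)ᴴ * (U * A * Uᴴ) = U * (Aᴴ * A * Uᴴ) := by
    simp only [Matrix.conjTranspose_mul, Matrix.conjTranspose_conjTranspose, Matrix.mul_assoc]
    rw [← Matrix.mul_assoc Uᴴ U, hU, Matrix.one_mul]
  rw [h, Matrix.charpoly_mul_comm, Matrix.mul_assoc, hU, Matrix.mul_one]

theorem kroneckerConj_mulVec_mem_admissible {d : ℕ} {U : Matrix (Fin d) (Fin d) ℂ}
    (hU : Uᴴ * U = 1) {α : ℝ} {ψ : EuclideanSpace ℂ (Fin d × Fin d)} (hψ : ψ ∈ admissible d d α) :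
    WithLp.toLp 2 (kroneckerConj U *ᵥ ψ.ofLp) ∈ admissible d d α := by
  obtain ⟨h1, h2, h3⟩ := hψ
  refine ⟨?_, ?_, ?_⟩
  · have := sum_sq_schmidtCoeff (WithLp.toLp 2 (kroneckerConj U *ᵥ ψ.ofLp))
    simp_rw [schmidtCoeff_kroneckerConj_mulVec hU, sum_sq_schmidtCoeff, h1, one_pow] at this
    exact (pow_eq_one_iff_of_nonneg (norm_nonneg _) two_ne_zero).1 this.symm
  · simpa only [schmidtCoeff_kroneckerConj_mulVec hU] using h2
  · simpa only [schmidtCoeff_kroneckerConj_mulVec hU] using h3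

theorem rankOne_mulVec {ι : Type*} [Fintype ι] (W : Matrix ι ι ℂ) (ψ : EuclideanSpace ℂ ι) :
    rankOne (WithLp.toLp 2 (W *ᵥ ψ.ofLp)) = W * rankOne ψ * Wᴴ := by
  have h : (fun j => star ((W *ᵥ ψ.ofLp) j)) = (fun j => star (ψ j)) ᵥ* Wᴴ := by
    exact Matrix.star_mulVec W ψ.ofLp
  rw [rankOne, rankOne, Matrix.mul_vecMulVec, Matrix.vecMulVec_mul, ← h]

theorem trace_rankOne {ι : Type*} [Fintype ι] (ψ : EuclideanSpace ℂ ι) :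
    (rankOne ψ).trace = ((‖ψ‖ ^ 2 : ℝ) : ℂ) := by
  rw [EuclideanSpace.norm_sq_eq]
  simp [Matrix.trace, rankOne, Matrix.vecMulVec_apply, Complex.mul_conj,
    Complex.normSq_eq_norm_sq]

/-! ### The cone `K_α` -/

theorem convex_fracCone (d : ℕ) (α : ℝ) : Convex ℝ (fracCone d d α) :=
  (PointedCone.hull ℝ (rankOne '' admissible d d α)).convex.closure

theorem rankOne_mem_fracCone {d : ℕ} {α : ℝ} {ψ : EuclideanSpace ℂ (Fin d × Fin d)}
    (hψ : ψ ∈ admissible d d α) : rankOne ψ ∈ fracCone d d α :=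
  subset_closure (Submodule.subset_span ⟨ψ, hψ, rfl⟩)

theorem conj_mem_fracCone {d : ℕ} {U : Matrix (Fin d) (Fin d) ℂ} (hU : Uᴴ * U = 1) {α : ℝ}
    {X : Matrix (Fin d × Fin d) (Fin d × Fin d) ℂ} (hX : X ∈ fracCone d d α) :
    kroneckerConj U * X * (kroneckerConj U)ᴴ ∈ fracCone d d α := by
  have hc : Continuous fun X : Matrix (Fin d × Fin d) (Fin d × Fin d) ℂ =>
      kroneckerConj U * X * (kroneckerConj U)ᴴ := by fun_prop
  refine map_mem_closure (f := fun X => kroneckerConj U * X * (kroneckerConj U)ᴴ) hc hX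
    fun Y hY => ?_
  refine Submodule.span_induction (p := fun Y _ => kroneckerConj U * Y * (kroneckerConj U)ᴴ ∈
    (PointedCone.hull ℝ (rankOne '' admissible d d α) : Set _)) ?_ ?_ ?_ ?_ hY
  · rintro _ ⟨ψ, hψ, rfl⟩
    rw [← rankOne_mulVec]
    exact Submodule.subset_span ⟨_, kroneckerConj_mulVec_mem_admissible hU hψ, rfl⟩
  · simp
  · intro X Y _ _ hX hY
    rw [Matrix.mul_add, Matrix.add_mul]
    exact Submodule.add_mem _ hX hY
  · intro c X _ hX
    rw [Matrix.mul_smul, Matrix.smul_mul]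
    exact Submodule.smul_mem _ c hX

/-- On the cone `K_α` the functional `ρ ↦ tr (P_ω ρ)` is bounded by `f_d(α) * tr ρ`, as it is on
the generators. -/
theorem re_trace_projMaxEntangled_mul_le {d : ℕ} {α c : ℝ}
    (hc : ∀ ψ ∈ admissible d d α, quadForm (projMaxEntangled d) ψ ≤ c)
    {X : Matrix (Fin d × Fin d) (Fin d × Fin d) ℂ} (hX : X ∈ fracCone d d α) :
    (projMaxEntangled d * X).trace.re ≤ c * X.trace.re := by
  have hclosed : IsClosed {X : Matrix (Fin d × Fin d) (Fin d × Fin d) ℂ |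
      (projMaxEntangled d * X).trace.re ≤ c * X.trace.re} :=
    isClosed_le (by fun_prop) (by fun_prop)
  refine closure_minimal (fun Y hY => ?_) hclosed hX
  refine Submodule.span_induction (p := fun Y _ =>
    (projMaxEntangled d * Y).trace.re ≤ c * Y.trace.re) ?_ ?_ ?_ ?_ hY
  · rintro _ ⟨ψ, hψ, rfl⟩
    rw [← quadForm_eq_re_trace, trace_rankOne, hψ.1]
    simpa using hc ψ hψ
  · simp
  · intro X Y _ _ hX hY
    rw [Matrix.mul_add, Matrix.trace_add, Matrix.trace_add, Complex.add_re, Complex.add_re, mul_add]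
    exact add_le_add hX hY
  · intro r X _ hX
    have h := mul_le_mul_of_nonneg_left hX r.2
    have h2 (z : ℂ) : (r • z).re = (r : ℝ) * z.re := Complex.smul_re (r : ℝ) z
    rw [Matrix.mul_smul, Matrix.trace_smul, Matrix.trace_smul, h2, h2]
    linarith

theorem conjTranspose_projMaxEntangled (d : ℕ) : (projMaxEntangled d)ᴴ = projMaxEntangled d := by
  ext p q
  rw [Matrix.conjTranspose_apply, projMaxEntangled_apply, projMaxEntangled_apply]
  by_cases h1 : p.1 = p.2 <;> by_cases h2 : q.1 = q.2 <;> simp [h1, h2]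

theorem kroneckerConj_mul_projMaxEntangled {d : ℕ} {U : Matrix (Fin d) (Fin d) ℂ}
    (hU : U * Uᴴ = 1) : kroneckerConj U * projMaxEntangled d = projMaxEntangled d := by
  ext ⟨i, j⟩ ⟨k, l⟩
  have h := congrFun (congrFun hU i) j
  rw [Matrix.mul_apply] at h
  simp only [Matrix.conjTranspose_apply] at h
  rw [Matrix.mul_apply, Fintype.sum_prod_type]
  by_cases hkl : k = l
  · simp [projMaxEntangled_apply, kroneckerConj_apply, hkl, ← Finset.sum_mul]
    simp only [RCLike.star_def] at h
    rw [h, Matrix.one_apply]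
    simp
  · simp [projMaxEntangled_apply, hkl]

theorem trace_projMaxEntangled_mul_conj {d : ℕ} {U : Matrix (Fin d) (Fin d) ℂ}
    (hU : Uᴴ * U = 1) (X : Matrix (Fin d × Fin d) (Fin d × Fin d) ℂ) :
    (projMaxEntangled d * (kroneckerConj U * X * (kroneckerConj U)ᴴ)).trace =
      (projMaxEntangled d * X).trace := by
  have h1 := kroneckerConj_mul_projMaxEntangled (mul_eq_one_comm.1 hU)
  have h2 : (kroneckerConj U)ᴴ * projMaxEntangled d = projMaxEntangled d := by
    conv_lhs => rw [← h1]
    rw [← Matrix.mul_assoc, conjTranspose_kroneckerConj_mul_self hU, Matrix.one_mul]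
  have h3 : projMaxEntangled d * kroneckerConj U = projMaxEntangled d := by
    simpa [conjTranspose_projMaxEntangled] using congrArg Matrix.conjTranspose h2
  rw [← Matrix.mul_assoc, Matrix.trace_mul_comm, ← Matrix.mul_assoc, ← Matrix.mul_assoc, h2, h3]

theorem trace_kroneckerConj_conj {d : ℕ} {U : Matrix (Fin d) (Fin d) ℂ}
    (hU : Uᴴ * U = 1) (X : Matrix (Fin d × Fin d) (Fin d × Fin d) ℂ) :
    (kroneckerConj U * X * (kroneckerConj U)ᴴ).trace = X.trace := by
  rw [Matrix.trace_mul_comm, ← Matrix.mul_assoc, conjTranspose_kroneckerConj_mul_self hU,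
    Matrix.one_mul]

/-! ### Matrices commuting with every `U ⊗ Ū` -/

theorem kroneckerConj_diagonal {d : ℕ} (u : Fin d → ℂ) :
    kroneckerConj (Matrix.diagonal u) =
      Matrix.diagonal fun p : Fin d × Fin d => u p.1 * star (u p.2) := by
  ext ⟨i, j⟩ ⟨k, l⟩
  by_cases h1 : i = k <;> by_cases h2 : j = l <;>
    simp [kroneckerConj_apply, h1, h2]

/-- A matrix commuting with `U ⊗ Ū` for all diagonal phases `U` lives on the positions
`(i, j), (i, j)` and `(i, i), (j, j)`. It is enough to let `U` multiply one coordinate by `I`. -/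
theorem eq_zero_of_commute_kroneckerConj_diagonal {d : ℕ}
    {X : Matrix (Fin d × Fin d) (Fin d × Fin d) ℂ}
    (hX : ∀ U : Matrix (Fin d) (Fin d) ℂ, Uᴴ * U = 1 →
      kroneckerConj U * X = X * kroneckerConj U)
    {p q : Fin d × Fin d} (hpq : p ≠ q) (hdiag : ¬(p.1 = p.2 ∧ q.1 = q.2)) : X p q = 0 := by
  have hphase (m : Fin d) : (((if p.1 = m then Complex.I else 1) *
      star (if p.2 = m then Complex.I else 1)) - ((if q.1 = m then Complex.I else 1) *
      star (if q.2 = m then Complex.I else 1))) * X p q = 0 := by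
    have hU := hX (Matrix.diagonal fun i => if i = m then Complex.I else 1) (by
      rw [Matrix.diagonal_conjTranspose, Matrix.diagonal_mul_diagonal, ← Matrix.diagonal_one]
      congr 1
      ext i
      by_cases h : i = m <;> simp [h])
    rw [kroneckerConj_diagonal] at hU
    have := congrFun (congrFun hU p) q
    rw [Matrix.diagonal_mul, Matrix.mul_diagonal] at this
    rw [sub_mul, this]
    ring
  obtain ⟨i, j⟩ := p
  obtain ⟨k, l⟩ := q
  dsimp only at hphase hdiag
  have e1 : (1 : ℂ) - Complex.I ≠ 0 := fun h => by simpa using congrArg Complex.re h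
  have e2 : Complex.I - (1 : ℂ) ≠ 0 := fun h => by simpa using congrArg Complex.re h
  have e3 : Complex.I - -Complex.I ≠ 0 := fun h => by
    have := congrArg Complex.im h
    norm_num at this
  have e4 : -Complex.I - (1 : ℂ) ≠ 0 := fun h => by simpa using congrArg Complex.re h
  by_cases hij : i = j
  · have hkl : ¬k = l := fun h => hdiag ⟨hij, h⟩
    have h := hphase k
    subst hij
    by_cases hik : i = k <;> simpa [hik, Ne.symm hkl, e1] using h
  · by_cases hki : k = i
    · have hlj : ¬l = j := fun h => hpq (by rw [hki, h])
      have h := hphase j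
      simpa [hki, hij, hlj, e4] using h
    · have h := hphase i
      by_cases hli : l = i <;> simpa [hki, Ne.symm hij, hli, e2, e3] using h

theorem apply_perm_of_commute_kroneckerConj {d : ℕ}
    {X : Matrix (Fin d × Fin d) (Fin d × Fin d) ℂ}
    (hX : ∀ U : Matrix (Fin d) (Fin d) ℂ, Uᴴ * U = 1 →
      kroneckerConj U * X = X * kroneckerConj U)
    (σ : Equiv.Perm (Fin d)) (i j k l : Fin d) :
    X (σ i, σ j) (σ k, σ l) = X (i, j) (k, l) := by
  have hU := hX ((1 : Matrix (Fin d) (Fin d) ℂ).submatrix σ id) (by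
    rw [mul_eq_one_comm]
    ext i j
    simp [Matrix.mul_apply, Matrix.one_apply])
  have := congrFun (congrFun hU (i, j)) (σ k, σ l)
  simpa [Matrix.mul_apply, kroneckerConj_apply, Matrix.one_apply, Fintype.sum_prod_type] using this

theorem exists_perm_apply_eq_apply_eq {ι : Type*} [DecidableEq ι] {i₀ j₀ i j : ι} (h₀ : i₀ ≠ j₀)
    (h : i ≠ j) : ∃ σ : Equiv.Perm ι, σ i₀ = i ∧ σ j₀ = j := by
  have h1 : Equiv.swap i₀ i j₀ ≠ i := fun h1 => h₀ ((Equiv.swap i₀ i).injective (by simp [h1]))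
  refine ⟨Equiv.swap (Equiv.swap i₀ i j₀) j * Equiv.swap i₀ i, ?_, ?_⟩
  · rw [Equiv.Perm.mul_apply, Equiv.swap_apply_left, Equiv.swap_apply_of_ne_of_ne h1.symm h]
  · rw [Equiv.Perm.mul_apply, Equiv.swap_apply_left]

/-- A unitary with all entries nonzero: the complex reflection that multiplies the vector
`(1, …, 1)` by `I` and fixes its orthogonal complement. -/
theorem exists_unitary_apply_ne_zero {d : ℕ} (hd : 2 ≤ d) :
    ∃ U : Matrix (Fin d) (Fin d) ℂ, Uᴴ * U = 1 ∧ ∀ i j, U i j ≠ 0 := by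
  have hd0 : (d : ℂ) ≠ 0 := by
    have : d ≠ 0 := by omega
    exact_mod_cast this
  have hc : (Complex.I - 1) / d ≠ 0 := by
    refine div_ne_zero (fun h => ?_) hd0
    simpa using congrArg Complex.re h
  refine ⟨1 + Matrix.of fun _ _ => (Complex.I - 1) / d, ?_, fun i j => ?_⟩
  · ext i j
    have hmul : (-Complex.I - 1) * (Complex.I - 1) = 2 := by
      linear_combination -Complex.I_sq
    simp only [Matrix.mul_apply, Matrix.conjTranspose_apply, Matrix.add_apply, Matrix.of_apply,
      star_add, add_mul, mul_add, Finset.sum_add_distrib, Matrix.one_apply]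
    by_cases h : i = j
    · simp [h, apply_ite]
      field_simp
      linear_combination hmul
    · simp [h, Ne.symm h, apply_ite]
      field_simp
      linear_combination hmul
  · simp only [Matrix.add_apply, Matrix.of_apply, Matrix.one_apply]
    split_ifs
    · intro h
      field_simp at h
      have h1 := congrArg Complex.re h
      have h2 := congrArg Complex.im h
      simp at h2
    · simpa using hc

/-- The commutant of the matrices `U ⊗ Ū` is spanned by `1` and `P_ω`. Diagonal phases and
permutations leave three constants: `a` at `(i, i), (i, i)`, `b` at `(i, j), (i, j)` and `c` at
`(i, i), (j, j)`. Comparing one entry of `(U ⊗ Ū) X = X (U ⊗ Ū)` for a unitary without zero entries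
gives `a = b + c`. -/
theorem exists_eq_smul_one_add_smul_projMaxEntangled {d : ℕ} (hd : 2 ≤ d)
    {X : Matrix (Fin d × Fin d) (Fin d × Fin d) ℂ}
    (hX : ∀ U : Matrix (Fin d) (Fin d) ℂ, Uᴴ * U = 1 →
      kroneckerConj U * X = X * kroneckerConj U) :
    ∃ x y : ℂ, X = x • (1 : Matrix (Fin d × Fin d) (Fin d × Fin d) ℂ) +
      y • projMaxEntangled d := by
  have hzero {p q : Fin d × Fin d} := eq_zero_of_commute_kroneckerConj_diagonal hX (p := p) (q := q)
  have hperm := apply_perm_of_commute_kroneckerConj hX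
  obtain ⟨i₀, j₀, h₀⟩ : ∃ i₀ j₀ : Fin d, i₀ ≠ j₀ :=
    ⟨⟨0, by omega⟩, ⟨1, by omega⟩, by simp⟩
  set a := X (i₀, i₀) (i₀, i₀) with ha
  set b := X (i₀, j₀) (i₀, j₀) with hb
  set c := X (i₀, i₀) (j₀, j₀) with hc
  have haa (i : Fin d) : X (i, i) (i, i) = a := by
    have := hperm (Equiv.swap i₀ i) i₀ i₀ i₀ i₀
    rwa [Equiv.swap_apply_left] at this
  have hbb {i j : Fin d} (h : i ≠ j) : X (i, j) (i, j) = b := by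
    obtain ⟨σ, rfl, rfl⟩ := exists_perm_apply_eq_apply_eq h₀ h
    exact hperm σ _ _ _ _
  have hcc {i j : Fin d} (h : i ≠ j) : X (i, i) (j, j) = c := by
    obtain ⟨σ, rfl, rfl⟩ := exists_perm_apply_eq_apply_eq h₀ h
    exact hperm σ _ _ _ _
  have habc : a = b + c := by
    obtain ⟨U, hU, hU0⟩ := exists_unitary_apply_ne_zero hd
    have h := congrFun (congrFun (hX U hU) (i₀, i₀)) (i₀, j₀)
    rw [Matrix.mul_apply, Matrix.mul_apply, Finset.sum_eq_single (i₀, j₀)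
      (fun r _ hr => by rw [hzero hr fun h => h₀ h.2, mul_zero]) (by simp)] at h
    have hrow (k l : Fin d) : X (i₀, i₀) (k, l) =
        if k = l then c + (if k = i₀ then a - c else 0) else 0 := by
      by_cases hkl : k = l
      · subst hkl
        by_cases hk : k = i₀
        · subst hk
          simp [ha]
        · simp [hk, hcc (Ne.symm hk)]
      · rw [if_neg hkl]
        refine hzero (fun h => hkl ?_) fun h => hkl h.2
        rw [Prod.mk.injEq] at h
        rw [← h.1, ← h.2]
    have horth : ∑ k, U k i₀ * star (U k j₀) = 0 := by
      have := congrFun (congrFun hU j₀) i₀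
      rw [Matrix.mul_apply, Matrix.one_apply_ne h₀.symm] at this
      rw [← this]
      exact Finset.sum_congr rfl fun k _ => mul_comm _ _
    simp only [Fintype.sum_prod_type, hrow, kroneckerConj_apply, ite_mul, zero_mul,
      Finset.sum_ite_eq, Finset.mem_univ, if_true, add_mul, Finset.sum_add_distrib,
      Finset.sum_ite_eq', ← Finset.mul_sum, horth, mul_zero, zero_add] at h
    have hne : U i₀ i₀ * star (U i₀ j₀) ≠ 0 := mul_ne_zero (hU0 _ _) (star_ne_zero.2 (hU0 _ _))
    have h2 : (a - c - b) * (U i₀ i₀ * star (U i₀ j₀)) = 0 := by linear_combination -h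
    have h3 := (mul_eq_zero.1 h2).resolve_right hne
    linear_combination h3
  have hd0 : (d : ℂ) ≠ 0 := by
    have : d ≠ 0 := by omega
    exact_mod_cast this
  refine ⟨b, c * d, ?_⟩
  ext ⟨i, j⟩ ⟨k, l⟩
  rw [Matrix.add_apply, Matrix.smul_apply, Matrix.smul_apply, projMaxEntangled_apply,
    Matrix.one_apply, smul_eq_mul, smul_eq_mul]
  dsimp only
  by_cases hpq : (i, j) = (k, l)
  · obtain ⟨rfl, rfl⟩ := Prod.mk.inj hpq
    by_cases hij : i = j
    · subst hij
      simp [haa, habc, hd0]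
    · simp [hij, hbb hij]
  · by_cases hdiag : i = j ∧ k = l
    · obtain ⟨rfl, rfl⟩ := hdiag
      have hik : i ≠ k := fun h => hpq (by rw [h])
      simp [hik, hcc hik, hd0]
    · rw [hzero hpq hdiag, if_neg hpq, if_neg hdiag]
      simp

/-! ### The isotropic states in the cone -/

/-- A nonempty closed convex set of matrices has an element that is the only one with its Frobenius
norm: the element of least norm, by strict convexity of the norm. Every norm-preserving map of the
set into itself fixes it. -/
theorem exists_mem_forall_sum_norm_sq_eq {ι : Type*} [Fintype ι] {C : Set (Matrix ι ι ℂ)}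
    (hne : C.Nonempty) (hcl : IsClosed C) (hconv : Convex ℝ C) :
    ∃ X ∈ C, ∀ Y ∈ C, ∑ i, ∑ j, ‖Y i j‖ ^ 2 = ∑ i, ∑ j, ‖X i j‖ ^ 2 → Y = X := by
  let L : EuclideanSpace ℂ (ι × ι) →ₗ[ℝ] Matrix ι ι ℂ :=
    { toFun := fun v => Matrix.of fun i j => v (i, j)
      map_add' := fun _ _ => rfl
      map_smul' := fun _ _ => rfl }
  have hLc : Continuous L := by
    refine continuous_matrix fun i j => ?_
    exact PiLp.continuous_apply 2 (fun _ : ι × ι => ℂ) (i, j)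
  have hnorm (v : EuclideanSpace ℂ (ι × ι)) : ‖v‖ ^ 2 = ∑ i, ∑ j, ‖L v i j‖ ^ 2 := by
    rw [EuclideanSpace.norm_sq_eq, Fintype.sum_prod_type]
    rfl
  have hLs (Y : Matrix ι ι ℂ) : L (WithLp.toLp 2 fun p => Y p.1 p.2) = Y := rfl
  have hconv' : Convex ℝ (L ⁻¹' C) := hconv.linear_preimage L
  obtain ⟨Y₀, hY₀⟩ := hne
  obtain ⟨v, hv, hmin⟩ := exists_norm_eq_iInf_of_complete_convex (K := L ⁻¹' C)
    ⟨WithLp.toLp 2 fun p => Y₀ p.1 p.2, hY₀⟩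
    (hcl.preimage hLc).isComplete hconv' 0
  have hle (w : EuclideanSpace ℂ (ι × ι)) (hw : w ∈ L ⁻¹' C) : ‖v‖ ≤ ‖w‖ := by
    have : ‖(0 : EuclideanSpace ℂ (ι × ι)) - v‖ ≤ ‖0 - w‖ := by
      rw [hmin]
      exact ciInf_le (f := fun w : L ⁻¹' C => ‖0 - (w : EuclideanSpace ℂ (ι × ι))‖)
        ⟨0, by rintro _ ⟨w, rfl⟩; exact norm_nonneg _⟩ ⟨w, hw⟩
    simpa using this
  refine ⟨L v, hv, fun Y hY h => ?_⟩
  rw [← hLs Y] at hY h ⊢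
  generalize (WithLp.toLp 2 fun p : ι × ι => Y p.1 p.2 : EuclideanSpace ℂ (ι × ι)) = w at *
  rw [← hnorm, ← hnorm, sq_eq_sq₀ (norm_nonneg _) (norm_nonneg _)] at h
  by_contra hvw
  have h1 : ‖(1 / 2 : ℝ) • v + (1 / 2 : ℝ) • w‖ < ‖v‖ :=
    norm_combo_lt_of_ne le_rfl h.le (fun h => hvw (by rw [h])) (by norm_num) (by norm_num)
      (by norm_num)
  exact absurd (hle _ (hconv' hv hY (by norm_num) (by norm_num) (by norm_num))) h1.not_ge

theorem sum_norm_sq_eq_re_trace {ι : Type*} [Fintype ι] (X : Matrix ι ι ℂ) :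
    ∑ i, ∑ j, ‖X i j‖ ^ 2 = (Xᴴ * X).trace.re := by
  rw [Finset.sum_comm]
  simp only [Matrix.trace, Matrix.diag_apply, Matrix.mul_apply, Matrix.conjTranspose_apply,
    Complex.re_sum, RCLike.star_def, ← Complex.normSq_eq_conj_mul_self, Complex.ofReal_re,
    Complex.normSq_eq_norm_sq]

/-- The product vector `e_1 ⊗ e_2`: admissible for every `α`, and orthogonal to `ω`. -/
theorem exists_mem_admissible_trace_eq_zero {d : ℕ} (hd : 2 ≤ d) {α : ℝ} (hα : 1 ≤ α) :
    ∃ ψ ∈ admissible d d α, (matricization ψ).trace = 0 := by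
  let i₀ : Fin d := ⟨0, by omega⟩
  let j₀ : Fin d := ⟨1, by omega⟩
  have h₀ : i₀ ≠ j₀ := by simp [i₀, j₀]
  let ψ : EuclideanSpace ℂ (Fin d × Fin d) := EuclideanSpace.single (i₀, j₀) 1
  have hmat : matricization ψ = Matrix.vecMulVec (Pi.single i₀ 1) (Pi.single j₀ 1) := by
    ext i j
    by_cases hi : i = i₀ <;> by_cases hj : j = j₀ <;>
      simp [ψ, matricization, Matrix.vecMulVec_apply, hi, hj]
  have hs {j : ℕ} (hj : 1 ≤ j) : schmidtCoeff ψ j = 0 :=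
    schmidtCoeff_eq_zero_of_rank_le_one (by rw [hmat]; exact Matrix.rank_vecMulVec_le _ _) hj
  have hk : 1 ≤ ⌊α⌋₊ := Nat.le_floor (by simpa using hα)
  refine ⟨ψ, ⟨by simp [ψ], fun j hj => hs (hk.trans ((Nat.floor_le_ceil α).trans hj)),
    fun h => ?_⟩, ?_⟩
  · rw [hs hk]
    exact mul_nonneg (div_nonneg h.le (Nat.cast_nonneg _))
      (Finset.sum_nonneg fun j _ => schmidtCoeff_nonneg ψ j)
  · rw [hmat, Matrix.trace_vecMulVec]
    simp [h₀]

theorem trace_projMaxEntangled {d : ℕ} (hd : 2 ≤ d) : (projMaxEntangled d).trace = 1 := by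
  have hd0 : (d : ℂ) ≠ 0 := by
    have : d ≠ 0 := by omega
    exact_mod_cast this
  simp [Matrix.trace, projMaxEntangled_apply, Fintype.sum_prod_type, hd0]

theorem projMaxEntangled_mul_self {d : ℕ} (hd : 2 ≤ d) :
    projMaxEntangled d * projMaxEntangled d = projMaxEntangled d := by
  have hd0 : (d : ℂ) ≠ 0 := by
    have : d ≠ 0 := by omega
    exact_mod_cast this
  ext p q
  simp only [Matrix.mul_apply, projMaxEntangled_apply, Fintype.sum_prod_type]
  by_cases hp : p.1 = p.2 <;> by_cases hq : q.1 = q.2 <;> simp [hp, hq, hd0]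

theorem trace_isotropicState {d : ℕ} (hd : 2 ≤ d) (F : ℝ) : (isotropicState d F).trace = 1 := by
  have h1 : (d : ℂ) ^ 2 - 1 ≠ 0 := by
    have : (1 : ℝ) < (d : ℝ) ^ 2 := one_lt_pow₀ (by exact_mod_cast hd) two_ne_zero
    exact_mod_cast (sub_pos.2 this).ne'
  rw [isotropicState, Matrix.trace_add, Matrix.trace_smul, Matrix.trace_smul, Matrix.trace_sub,
    trace_projMaxEntangled hd]
  simp
  field_simp
  ring

theorem trace_projMaxEntangled_mul_isotropicState {d : ℕ} (hd : 2 ≤ d) (F : ℝ) :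
    (projMaxEntangled d * isotropicState d F).trace = F := by
  rw [isotropicState, Matrix.mul_add, Matrix.mul_smul, Matrix.mul_smul, Matrix.mul_sub,
    projMaxEntangled_mul_self hd, Matrix.mul_one, sub_self, smul_zero, zero_add,
    Matrix.trace_smul, trace_projMaxEntangled hd]
  simp

/-- The density matrices in `K_α` with overlap `F` form a closed convex set that is invariant under
conjugation by the matrices `U ⊗ Ū`. If it is nonempty, its element of least Frobenius norm is
unique, hence commutes with all of them, hence is the isotropic state. -/
theorem isotropicState_mem_fracCone_of_trace_eq {d : ℕ} (hd : 2 ≤ d) {α F : ℝ}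
    {X₀ : Matrix (Fin d × Fin d) (Fin d × Fin d) ℂ} (hX₀ : X₀ ∈ fracCone d d α)
    (htr : X₀.trace = 1) (hF : (projMaxEntangled d * X₀).trace = F) :
    isotropicState d F ∈ fracCone d d α := by
  set C : Set (Matrix (Fin d × Fin d) (Fin d × Fin d) ℂ) :=
    fracCone d d α ∩ {X | X.trace = 1 ∧ (projMaxEntangled d * X).trace = F} with hC
  have hcl : IsClosed C := by
    refine isClosed_closure.inter (IsClosed.inter ?_ ?_)
    · exact isClosed_eq (by fun_prop) (by fun_prop)
    · exact isClosed_eq (by fun_prop) (by fun_prop)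
  have hconv : Convex ℝ C := by
    refine (convex_fracCone d α).inter fun X hX Y hY a b _ _ hab => ?_
    have hab' : (a : ℂ) + b = 1 := by exact_mod_cast hab
    refine ⟨?_, ?_⟩
    · rw [Matrix.trace_add, Matrix.trace_smul, Matrix.trace_smul, hX.1, hY.1]
      simpa using hab'
    · rw [Matrix.mul_add, Matrix.mul_smul, Matrix.mul_smul, Matrix.trace_add, Matrix.trace_smul,
        Matrix.trace_smul, hX.2, hY.2, ← add_smul, hab, one_smul]
  obtain ⟨X, ⟨hXK, hXtr, hXF⟩, huniq⟩ :=
    exists_mem_forall_sum_norm_sq_eq (C := C) ⟨X₀, hX₀, htr, hF⟩ hcl hconv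
  have hcomm (U : Matrix (Fin d) (Fin d) ℂ) (hU : Uᴴ * U = 1) :
      kroneckerConj U * X = X * kroneckerConj U := by
    have hW := conjTranspose_kroneckerConj_mul_self hU
    have h := huniq (kroneckerConj U * X * (kroneckerConj U)ᴴ)
      ⟨conj_mem_fracCone hU hXK, by rw [trace_kroneckerConj_conj hU, hXtr],
        by rw [trace_projMaxEntangled_mul_conj hU, hXF]⟩ (by
        rw [sum_norm_sq_eq_re_trace, sum_norm_sq_eq_re_trace,
          ← trace_kroneckerConj_conj hU (Xᴴ * X)]
        congr 2
        simp only [Matrix.conjTranspose_mul, Matrix.conjTranspose_conjTranspose, Matrix.mul_assoc]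
        rw [← Matrix.mul_assoc (kroneckerConj U)ᴴ (kroneckerConj U), hW, Matrix.one_mul])
    conv_rhs => rw [← h]
    rw [Matrix.mul_assoc (kroneckerConj U * X), hW, Matrix.mul_one]
  obtain ⟨x, y, hxy⟩ := exists_eq_smul_one_add_smul_projMaxEntangled hd hcomm
  have h1 : x * (d : ℂ) ^ 2 + y = 1 := by
    rw [← hXtr, hxy, Matrix.trace_add, Matrix.trace_smul, Matrix.trace_smul,
      trace_projMaxEntangled hd]
    simp [sq]
  have h2 : x + y = F := by
    rw [← hXF, hxy, Matrix.mul_add, Matrix.mul_smul, Matrix.mul_smul, Matrix.mul_one,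
      projMaxEntangled_mul_self hd, Matrix.trace_add, Matrix.trace_smul, Matrix.trace_smul,
      trace_projMaxEntangled hd]
    simp
  have h3 : (d : ℂ) ^ 2 - 1 ≠ 0 := by
    have : (1 : ℝ) < (d : ℝ) ^ 2 := one_lt_pow₀ (by exact_mod_cast hd) two_ne_zero
    exact_mod_cast (sub_pos.2 this).ne'
  have hx : x = (((1 - F) / ((d : ℝ) ^ 2 - 1) : ℝ) : ℂ) := by
    push_cast
    rw [eq_div_iff h3]
    linear_combination h1 - h2
  have hX : isotropicState d F = X := by
    rw [hxy, isotropicState]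
    ext p q
    simp only [Matrix.add_apply, Matrix.smul_apply, Matrix.sub_apply, Complex.real_smul,
      smul_eq_mul]
    rw [← hx, ← h2]
    ring
  rw [hX]
  exact hXK

/-- The isotropic state `ρ_F` lies in `K_α` exactly when `F ≤ f_d(α)`. -/
theorem isotropicState_mem_fracCone_iff {d : ℕ} (hd : 2 ≤ d) {α F : ℝ}
    (hα : α ∈ Set.Icc (1 : ℝ) d) (hF : 0 ≤ F) :
    isotropicState d F ∈ fracCone d d α ↔ F ≤ isotropicProfile d α := by
  constructor
  · intro h
    have h1 := re_trace_projMaxEntangled_mul_le (c := isotropicProfile d α)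
      (fun ψ hψ => by
        rw [isotropicProfile_eq hα]
        exact quadForm_le_of_mem_admissible hα hψ) h
    rw [trace_isotropicState hd, trace_projMaxEntangled_mul_isotropicState hd] at h1
    simpa using h1
  · intro h
    obtain ⟨ψ, hψ, hψf⟩ := exists_mem_admissible_quadForm_eq hα
    obtain ⟨φ, hφ, hφf⟩ := exists_mem_admissible_trace_eq_zero hd hα.1
    rw [← isotropicProfile_eq hα] at hψf
    -- `ψψ*` has overlap `f_d(α)` and `φφ*` has overlap `0`; mix them to reach `F`.
    obtain ⟨t, ht0, ht1, ht⟩ : ∃ t : ℝ, 0 ≤ t ∧ t ≤ 1 ∧ t * isotropicProfile d α = F := by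
      rcases (hF.trans h).eq_or_lt with h0 | h0
      · exact ⟨0, le_rfl, zero_le_one, by linarith⟩
      · exact ⟨F / isotropicProfile d α, by positivity, (div_le_one h0).2 h,
          div_mul_cancel₀ _ h0.ne'⟩
    refine isotropicState_mem_fracCone_of_trace_eq hd
      (convex_fracCone d α (rankOne_mem_fracCone hφ) (rankOne_mem_fracCone hψ)
        (sub_nonneg.2 ht1) ht0 (by ring)) ?_ ?_
    · rw [Matrix.trace_add, Matrix.trace_smul, Matrix.trace_smul, trace_rankOne, trace_rankOne,
        hφ.1, hψ.1]
      simp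
    · rw [quadForm_projMaxEntangled] at hψf
      rw [Matrix.mul_add, Matrix.mul_smul, Matrix.mul_smul, Matrix.trace_add, Matrix.trace_smul,
        Matrix.trace_smul, trace_projMaxEntangled_mul_rankOne, trace_projMaxEntangled_mul_rankOne,
        hψf, hφf, ← ht]
      simp

/-! ### Inverting the profile -/

theorem add_sq_div_lt_add_sq_div {x θ η : ℝ} (hx : 1 ≤ x) (hθ : 0 ≤ θ) (hθη : θ < η)
    (hη : η ≤ 1) : (x + θ) ^ 2 / (x + θ ^ 2) < (x + η) ^ 2 / (x + η ^ 2) := by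
  rw [div_lt_div_iff₀ (by positivity) (by positivity), ← sub_pos]
  have h1 : 0 < x * (2 - η - θ) := mul_pos (by linarith) (by linarith)
  have h2 : 0 ≤ η * (1 - θ) := mul_nonneg (by linarith) (by linarith)
  have h3 : 0 ≤ θ * (1 - η) := mul_nonneg hθ (by linarith)
  have h4 : 0 < x * (η - θ) * (x * (2 - η - θ) + η * (1 - θ) + θ * (1 - η)) :=
    mul_pos (mul_pos (by linarith) (by linarith)) (by linarith)
  linarith

/-- The formula for the profile in terms of `k` and `θ`; it also holds at the right end `θ = 1`,
where `⌊k + θ⌋ = k + 1`. -/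
theorem isotropicProfile_natCast_add {d k : ℕ} {θ : ℝ} (hk : 1 ≤ k) (hθ0 : 0 ≤ θ) (hθ1 : θ ≤ 1)
    (hd : k + θ ≤ d) :
    isotropicProfile d (k + θ) = (k + θ) ^ 2 / (k + θ ^ 2) / d := by
  have hk1 : (1 : ℝ) ≤ k := by exact_mod_cast hk
  rw [isotropicProfile_eq ⟨by linarith, hd⟩, div_div, mul_comm (d : ℝ)]
  rcases hθ1.lt_or_eq with h | rfl
  · have : ⌊(k : ℝ) + θ⌋₊ = k := by
      rw [Nat.floor_eq_iff (by positivity)]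
      exact ⟨by linarith, by linarith⟩
    rw [this, add_sub_cancel_left]
  · have : ⌊(k : ℝ) + 1⌋₊ = k + 1 := by exact_mod_cast Nat.floor_natCast (R := ℝ) (k + 1)
    rw [this]
    push_cast
    have hd0 : (0 : ℝ) < d := by linarith
    field_simp
    ring

theorem strictMonoOn_isotropicProfile {d : ℕ} (hd : 2 ≤ d) :
    StrictMonoOn (isotropicProfile d) (Set.Icc (1 : ℝ) d) := by
  have hd0 : (0 : ℝ) < d := by
    have : 0 < d := by omega
    exact_mod_cast this
  have hf {α : ℝ} (hα : α ∈ Set.Icc (1 : ℝ) d) : isotropicProfile d α =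
      (⌊α⌋₊ + (α - ⌊α⌋₊)) ^ 2 / (⌊α⌋₊ + (α - ⌊α⌋₊) ^ 2) / d := by
    rw [isotropicProfile_eq hα, div_div, mul_comm (d : ℝ)]
  intro α hα β hβ hαβ
  obtain ⟨hk, -, hθ0, hθ1, -⟩ := floor_bounds hα
  obtain ⟨hl, -, hη0, hη1, -⟩ := floor_bounds hβ
  have hk1 : (1 : ℝ) ≤ ⌊α⌋₊ := by exact_mod_cast hk
  have hl1 : (1 : ℝ) ≤ ⌊β⌋₊ := by exact_mod_cast hl
  rw [hf hα, hf hβ]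
  refine div_lt_div_of_pos_right ?_ hd0
  rcases (Nat.floor_mono hαβ.le).eq_or_lt with h | h
  · rw [h] at hθ0 ⊢
    exact add_sq_div_lt_add_sq_div hl1 hθ0 (by linarith) hη1.le
  · -- the values over `[k, k + 1)` stay below `k + 1`, those over `[l, l + 1)` are at least `l`
    have h1 := add_sq_div_lt_add_sq_div hk1 hθ0 hθ1 le_rfl
    have h2 : ((⌊α⌋₊ : ℝ) + 1) ^ 2 / (⌊α⌋₊ + 1 ^ 2) = ⌊α⌋₊ + 1 := by
      field_simp
    have h3 : (⌊β⌋₊ : ℝ) ≤ (⌊β⌋₊ + (β - ⌊β⌋₊)) ^ 2 / (⌊β⌋₊ + (β - ⌊β⌋₊) ^ 2) := by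
      rcases hη0.eq_or_lt with h0 | h0
      · rw [← h0]
        apply le_of_eq
        field_simp
        ring
      · have := add_sq_div_lt_add_sq_div hl1 le_rfl h0 hη1.le
        have h4 : ((⌊β⌋₊ : ℝ) + 0) ^ 2 / (⌊β⌋₊ + 0 ^ 2) = ⌊β⌋₊ := by
          field_simp
          ring
        rw [h4] at this
        exact this.le
    have h5 : (⌊α⌋₊ : ℝ) + 1 ≤ ⌊β⌋₊ := by exact_mod_cast h
    linarith

theorem isotropicProfile_one {d : ℕ} (hd : 2 ≤ d) : isotropicProfile d 1 = 1 / d := by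
  have hd1 : (1 : ℝ) ≤ d := by exact_mod_cast (by omega : 1 ≤ d)
  have := isotropicProfile_natCast_add (d := d) (k := 1) le_rfl le_rfl zero_le_one
    (by simpa using hd1)
  simpa using this

theorem fracSchmidtIndex_isotropicState {d : ℕ} (hd : 2 ≤ d) {F : ℝ} (hF : 0 ≤ F) :
    fracSchmidtIndex (isotropicState d F) =
      sInf {α : ℝ | α ∈ Set.Icc (1 : ℝ) d ∧ F ≤ isotropicProfile d α} := by
  rw [fracSchmidtIndex, min_self]
  congr 1
  ext α
  exact and_congr_right fun hα => isotropicState_mem_fracCone_iff hd hα hF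

theorem fracSchmidtIndex_isotropicState_of_eq {d : ℕ} (hd : 2 ≤ d) {F α : ℝ} (hF : 0 ≤ F)
    (hα : α ∈ Set.Icc (1 : ℝ) d) (h : F = isotropicProfile d α) :
    fracSchmidtIndex (isotropicState d F) = α := by
  rw [fracSchmidtIndex_isotropicState hd hF, ← csInf_Icc hα.2]
  congr 1
  ext β
  constructor
  · rintro ⟨hβ, hle⟩
    rw [h, (strictMonoOn_isotropicProfile hd).le_iff_le hα hβ] at hle
    exact ⟨hle, hβ.2⟩
  · rintro ⟨h1, h2⟩
    have hβ : β ∈ Set.Icc (1 : ℝ) d := ⟨hα.1.trans h1, h2⟩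
    exact ⟨hβ, h.trans_le (((strictMonoOn_isotropicProfile hd).le_iff_le hα hβ).2 h1)⟩

theorem fracSchmidtIndex_isotropicState_of_le {d : ℕ} (hd : 2 ≤ d) {F : ℝ} (hF : 0 ≤ F)
    (h : F ≤ 1 / d) : fracSchmidtIndex (isotropicState d F) = 1 := by
  have hd1 : (1 : ℝ) ≤ d := by exact_mod_cast (by omega : 1 ≤ d)
  rw [fracSchmidtIndex_isotropicState hd hF]
  refine (IsLeast.csInf_eq ⟨⟨⟨le_rfl, hd1⟩, ?_⟩, fun β hβ => hβ.1.1⟩)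
  rwa [isotropicProfile_one hd]

/-- The smaller root of the quadratic equation, for `x ∈ [k, k + 1]`, lies in `[0, 1]`. -/
theorem exists_root_mem_Icc {x k : ℝ} (hk : 1 ≤ k) (hkx : k ≤ x) (hxk : x ≤ k + 1) :
    ∃ θ ∈ Set.Icc (0 : ℝ) 1, (x - 1) * θ ^ 2 - 2 * k * θ + k * (x - k) = 0 ∧
      (k < x → 0 < x - 1 ∧ 0 ≤ k ^ 2 - k * (x - 1) * (x - k) ∧
        θ = (k - Real.sqrt (k ^ 2 - k * (x - 1) * (x - k))) / (x - 1)) ∧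
      (x = k → θ = 0) := by
  rcases hkx.eq_or_lt with rfl | h
  · exact ⟨0, by simp, by simp, fun h => absurd h (lt_irrefl _), fun _ => rfl⟩
  have hx1 : 0 < x - 1 := by linarith
  have hε : 0 ≤ k + 1 - x := by linarith
  -- with `ε = k + 1 - x` the radicand is `k ε (k + 1 - ε)`, and `ε ≤ k (k + 1 - ε)`
  have hD : (k + 1 - x) ^ 2 ≤ k ^ 2 - k * (x - 1) * (x - k) := by
    have h1 : 0 ≤ (k + 1 - x) * ((k + 1) * (k - (k + 1 - x))) :=
      mul_nonneg hε (mul_nonneg (by linarith) (by linarith))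
    linarith
  have hD0 := (sq_nonneg _).trans hD
  have hs1 := Real.le_sqrt_of_sq_le hD
  have hs2 : Real.sqrt (k ^ 2 - k * (x - 1) * (x - k)) ≤ k := by
    rw [Real.sqrt_le_left (by linarith)]
    have : 0 ≤ k * (x - 1) * (x - k) :=
      mul_nonneg (mul_nonneg (by linarith) hx1.le) (by linarith)
    linarith
  have hsq := Real.sq_sqrt hD0
  generalize Real.sqrt (k ^ 2 - k * (x - 1) * (x - k)) = s at *
  refine ⟨(k - s) / (x - 1), ⟨div_nonneg (by linarith) hx1.le, (div_le_one hx1).2 (by linarith)⟩,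
    ?_, fun _ => ⟨hx1, hD0, rfl⟩, fun h' => absurd h' h.ne'⟩
  field_simp
  linear_combination hsq

theorem eq_isotropicProfile_iff {d k : ℕ} (hk : 1 ≤ k) (hkd : k + 1 ≤ d) {F θ : ℝ}
    (hθ : θ ∈ Set.Icc (0 : ℝ) 1) : F = isotropicProfile d (k + θ) ↔
      (F * d - 1) * θ ^ 2 - 2 * k * θ + k * (F * d - k) = 0 := by
  have hk1 : (1 : ℝ) ≤ k := by exact_mod_cast hk
  have hkd1 : (k : ℝ) + 1 ≤ d := by exact_mod_cast hkd
  have hd0 : (0 : ℝ) < d := by linarith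
  rw [isotropicProfile_natCast_add hk hθ.1 hθ.2 (by linarith [hθ.2]), eq_div_iff hd0.ne',
    eq_div_iff (by positivity)]
  constructor <;> intro h <;> linear_combination h

theorem exists_root_and_fracSchmidtIndex_eq {d : ℕ} (hd : 2 ≤ d) {F : ℝ} {k : ℕ} (hk : 1 ≤ k)
    (hkd : k + 1 ≤ d) (hF : F ∈ Set.Icc ((k : ℝ) / d) (((k : ℝ) + 1) / d)) :
    ∃ θ : ℝ, θ ∈ Set.Icc (0 : ℝ) 1 ∧
      (F * d - 1) * θ ^ 2 - 2 * k * θ + k * (F * d - k) = 0 ∧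
      (∀ η : ℝ, η ∈ Set.Icc (0 : ℝ) 1 →
        (F * d - 1) * η ^ 2 - 2 * k * η + k * (F * d - k) = 0 → η = θ) ∧
      fracSchmidtIndex (isotropicState d F) = k + θ ∧
      ((k : ℝ) / d < F →
        0 < F * d - 1 ∧
        0 ≤ (k : ℝ) ^ 2 - k * (F * d - 1) * (F * d - k) ∧
        θ = (k - Real.sqrt ((k : ℝ) ^ 2 - k * (F * d - 1) * (F * d - k))) / (F * d - 1)) ∧
      (F = (k : ℝ) / d → θ = 0) := by
  have hk1 : (1 : ℝ) ≤ k := by exact_mod_cast hk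
  have hkd1 : (k : ℝ) + 1 ≤ d := by exact_mod_cast hkd
  have hd0 : (0 : ℝ) < d := by linarith
  obtain ⟨θ, hθ, hroot, hform, hzero⟩ := exists_root_mem_Icc hk1 ((div_le_iff₀ hd0).1 hF.1)
    ((le_div_iff₀ hd0).1 hF.2)
  have hmem {η : ℝ} (hη : η ∈ Set.Icc (0 : ℝ) 1) : (k : ℝ) + η ∈ Set.Icc (1 : ℝ) d :=
    ⟨by linarith [hη.1], by linarith [hη.2]⟩
  have hFθ := (eq_isotropicProfile_iff hk hkd hθ).2 hroot
  refine ⟨θ, hθ, hroot, fun η hη h => ?_, ?_, fun h => hform ((div_lt_iff₀ hd0).1 h),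
    fun h => hzero ?_⟩
  · have hFη := (eq_isotropicProfile_iff hk hkd hη).2 h
    have := (strictMonoOn_isotropicProfile hd).injOn (hmem hη) (hmem hθ) (hFη.symm.trans hFθ)
    linarith
  · exact fracSchmidtIndex_isotropicState_of_eq hd ((by positivity : 0 ≤ (k : ℝ) / d).trans hF.1)
      (hmem hθ) hFθ
  · rw [h, div_mul_cancel₀ _ hd0.ne']

theorem exists_unique_eq_isotropicProfile {d : ℕ} (hd : 2 ≤ d) {F : ℝ} (hF0 : 1 / d < F)
    (hF1 : F ≤ 1) :
    ∃ α : ℝ, α ∈ Set.Ioc (1 : ℝ) d ∧ F = isotropicProfile d α ∧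
      (∀ β : ℝ, β ∈ Set.Ioc (1 : ℝ) d → F = isotropicProfile d β → β = α) ∧
      fracSchmidtIndex (isotropicState d F) = α := by
  have hd0 : (0 : ℝ) < d := by
    have : 0 < d := by omega
    exact_mod_cast this
  -- `k` is the integer with `k < F d ≤ k + 1`
  obtain ⟨k, hk⟩ : ∃ k : ℕ, ⌈F * d⌉₊ = k + 1 := by
    refine Nat.exists_eq_succ_of_ne_zero (Nat.ceil_pos.2 ?_).ne'
    exact mul_pos ((by positivity : 0 ≤ 1 / (d : ℝ)).trans_lt hF0) hd0
  rw [Nat.ceil_eq_iff (by omega)] at hk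
  simp only [Nat.add_sub_cancel, Nat.cast_add, Nat.cast_one] at hk
  have h1 : 1 < F * d := (div_lt_iff₀ hd0).1 hF0
  have h2 : F * d ≤ d := mul_le_of_le_one_left hd0.le hF1
  have hk1 : 1 ≤ k := by
    have : (0 : ℝ) < k := by linarith
    exact_mod_cast this
  have hkd : k + 1 ≤ d := by
    have : (k : ℝ) < d := by linarith
    exact_mod_cast this
  obtain ⟨θ, hθ, hroot, -, hindex, -⟩ := exists_root_and_fracSchmidtIndex_eq hd hk1 hkd
    ⟨(div_le_iff₀ hd0).2 hk.1.le, (le_div_iff₀ hd0).2 hk.2⟩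
  have hFθ := (eq_isotropicProfile_iff hk1 hkd hθ).2 hroot
  have hk1' : (1 : ℝ) ≤ k := by exact_mod_cast hk1
  have hkd' : (k : ℝ) + 1 ≤ d := by exact_mod_cast hkd
  have hα : (k : ℝ) + θ ∈ Set.Ioc (1 : ℝ) d := by
    refine ⟨lt_of_le_of_ne (by linarith [hθ.1]) fun h => ?_, by linarith [hθ.2]⟩
    rw [← h, isotropicProfile_one hd] at hFθ
    exact hF0.ne' hFθ
  refine ⟨k + θ, hα, hFθ, fun β hβ h => ?_, hindex⟩
  exact (strictMonoOn_isotropicProfile hd).injOn (Set.Ioc_subset_Icc_self hβ)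
    (Set.Ioc_subset_Icc_self hα) (h.symm.trans hFθ)

end

theorem mainTheorem7 (d : ℕ) (hd : 2 ≤ d) :
    -- the profile `f_d` is a maximum, with an explicit value
    (∀ α : ℝ, α ∈ Set.Icc (1 : ℝ) d →
      IsGreatest (quadForm (projMaxEntangled d) '' admissible d d α) (isotropicProfile d α) ∧
      isotropicProfile d α =
        ((⌊α⌋₊ : ℝ) + (α - ⌊α⌋₊)) ^ 2 / (d * ((⌊α⌋₊ : ℝ) + (α - ⌊α⌋₊) ^ 2))) ∧
    -- (i)
    (∀ F : ℝ, 0 ≤ F → F ≤ 1 / d → fracSchmidtIndex (isotropicState d F) = 1) ∧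
    -- (ii), inversion of the profile
    (∀ F : ℝ, 1 / d < F → F ≤ 1 →
      ∃ α : ℝ, α ∈ Set.Ioc (1 : ℝ) d ∧ F = isotropicProfile d α ∧
        (∀ β : ℝ, β ∈ Set.Ioc (1 : ℝ) d → F = isotropicProfile d β → β = α) ∧
        fracSchmidtIndex (isotropicState d F) = α) ∧
    -- (ii), explicit form
    (∀ (F : ℝ) (k : ℕ), 1 ≤ k → k + 1 ≤ d →
      F ∈ Set.Icc ((k : ℝ) / d) (((k : ℝ) + 1) / d) →
      ∃ θ : ℝ, θ ∈ Set.Icc (0 : ℝ) 1 ∧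
        (F * d - 1) * θ ^ 2 - 2 * k * θ + k * (F * d - k) = 0 ∧
        (∀ η : ℝ, η ∈ Set.Icc (0 : ℝ) 1 →
          (F * d - 1) * η ^ 2 - 2 * k * η + k * (F * d - k) = 0 → η = θ) ∧
        fracSchmidtIndex (isotropicState d F) = k + θ ∧
        ((k : ℝ) / d < F →
          0 < F * d - 1 ∧
          0 ≤ (k : ℝ) ^ 2 - k * (F * d - 1) * (F * d - k) ∧
          θ = (k - Real.sqrt ((k : ℝ) ^ 2 - k * (F * d - 1) * (F * d - k))) / (F * d - 1)) ∧
        (F = (k : ℝ) / d → θ = 0)) := by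
  refine ⟨fun α hα => ?_, fun F hF0 hF1 => fracSchmidtIndex_isotropicState_of_le hd hF0 hF1,
    fun F hF0 hF1 => exists_unique_eq_isotropicProfile hd hF0 hF1,
    fun F k hk hkd hF => exists_root_and_fracSchmidtIndex_eq hd hk hkd hF⟩
  rw [isotropicProfile_eq hα]
  exact ⟨isGreatest_quadForm_admissible hα, rfl⟩
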